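/- Let $n\ge 1$ and $m\ge 2$ be integers and let $\mathcal H$ be a complex Hilbert space. Let $\mathbb F_n^+$ be the free monoid on generators $g_1,\dots,g_n$ with identity $g_0$, and let $|\alpha|$ denote the length of $\alpha\in\mathbb F_n^+$. Let $F^2(H_n)$ be the full Fock space, with orthonormal basis $\{e_\alpha\}_{\alpha\in\mathbb F_n^+}$, let $S_1,\dots,S_n$ be the left creation operators, $S_ie_\alpha=e_{g_i\alpha}$, and put $S_\alpha=S_{i_1}\cdots S_{i_k}$ for $\alpha=g_{i_1}\cdots g_{i_k}$. For bounded operators $\mathcal A=\{A_{(\alpha)}\}_{|\alpha|\le m-1}$ on $\mathcal H$, with $A_{(0)}:=A_{(g_0)}$ selfadjoint, let $$H_{\mathcal A}(S_1,\dots,S_n)=\operatorname{Re}\Big(\tfrac12 I\otimes A_{(0)}+\sum_{1\le|\alpha|\le m-1}S_\alpha\otimes A_{(\alpha)}\Big),\qquad \operatorname{Re}T=\tfrac12(T+T^*),$$ acting on the Hilbert space tensor product $F^2(H_n)\otimes\mathcal H$. For bounded operators $X_1,\dots,X_N$ on $\mathcal H$, let $w(X_1,\dots,X_N)=\omega(S_1\otimes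 X_1^*+\cdots+S_N\otimes X_N^*)$ be the joint numerical radius, where $S_1,\dots,S_N$ are here the left creation operators on $F^2(H_N)$ and $\omega(T)=\sup\{|\langle Th,h\rangle|:\|h\|=1\}$. Write $[x]$ for the integer part of $x$. The equation $$\sum_{k=1}^{m-1}t^k\cos\frac{\pi}{\left[\frac{m-1}{k}\right]+2}=\frac12$$ has exactly one solution $t=t_m$ in $(0,1]$. Let $\mathcal A=\{A_{(\alpha)}\}_{|\alpha|\le m-1}$ and $\mathcal B=\{B_{(\alpha)}\}_{|\alpha|\le m-1}$ be families of bounded operators on $\mathcal H$ such that $A_{(0)}=A_{(0)}^*$, $B_{(0)}=B_{(0)}^*$ and $$H_{\mathcal A}(S_1,\dots,S_n)\le H_{\mathcal B}(S_1,\dots,S_n).$$ Then $$w\big(B_{(\alpha)}^*-A_{(\alpha)}^*:\ |\alpha|=k\big)\le\|B_{(0)}-A_{(0)}\|\cos\frac{\pi}{\left[\frac{m-1}{k}\right]+2}\qquad\text{for }1\le k\le m-1,$$ and $$\sum_{k=1}^{m-1}r^k\,w\big(A_{(\alpha)}^*:\ |\alpha|=k\big)\le\frac12\|B_{(0)}-A_{(0)}\|+\sum_{k=1}^{m-1}r^k\,w\big(B_{(\alpha)}^*:\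 |\alpha|=k\big)\qquad\text{for }r\in[0,t_m].$$ -/

import Mathlib

open scoped TensorProduct

noncomputable section

namespace NCHarmonic

/-! ### The full Fock space and the left creation operators

The words over an alphabet `ι` form the free monoid `FreeMonoid ι`, the empty word being `1`. -/

/-- The full Fock space over a Hilbert space with orthonormal basis indexed by `ι`:
the Hilbert space whose orthonormal basis consists of the vectors `e_α`,
one for each word `α = g_{i₁} ⋯ g_{iₖ}` (with `e_α = e_{i₁} ⊗ ⋯ ⊗ e_{iₖ}`). -/
abbrev Fock (ι : Type*) : Type _ := lp (fun _ : FreeMonoid ι => ℂ) 2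

open Classical in
/-- The basis vector `e_α`. -/
def fockBasis {ι : Type*} (α : FreeMonoid ι) : Fock ι := lp.single 2 α (1 : ℂ)

theorem fockBasis_orthonormal (ι : Type*) :
    Orthonormal ℂ (fun α : FreeMonoid ι => (fockBasis α : Fock ι)) := by
  classical
  rw [orthonormal_iff_ite]
  intro α β
  rw [fockBasis, fockBasis, lp.inner_single_left, lp.single_apply]
  by_cases h : α = β
  · subst h; simp
  · simp [h]

theorem shifted_orthonormal {ι : Type*} (i : ι) :
    Orthonormal ℂ (fun α : FreeMonoid ι => (fockBasis (FreeMonoid.of i * α) : Fock ι)) :=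
  (fockBasis_orthonormal ι).comp _ (mul_right_injective _)

/-- The left creation operator `S_i φ = e_i ⊗ φ`, that is, the isometry with
`S_i e_α = e_{g_i α}`. -/
def creation {ι : Type*} (i : ι) : Fock ι →L[ℂ] Fock ι :=
  (shifted_orthonormal i).orthogonalFamily.linearIsometry.toContinuousLinearMap

theorem creation_fockBasis {ι : Type*} (i : ι) (α : FreeMonoid ι) :
    creation i (fockBasis α) = fockBasis (FreeMonoid.of i * α) := by
  classical
  have h := (shifted_orthonormal i).orthogonalFamily.linearIsometry_apply_single (i := α) (1 : ℂ)
  rw [LinearIsometry.toSpanSingleton_apply, one_smul] at h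
  rw [creation, ← h, fockBasis]
  simp only [LinearIsometry.coe_toContinuousLinearMap]

/-- The product `T_α = T_{i₁} ⋯ T_{iₖ}` for `α = g_{i₁} ⋯ g_{iₖ}`, with `T_1 = I`. -/
def wordProd {ι E : Type*} [NormedAddCommGroup E] [InnerProductSpace ℂ E]
    (T : ι → E →L[ℂ] E) (α : FreeMonoid ι) : E →L[ℂ] E :=
  FreeMonoid.lift T α

/-- The words of length `k`. -/
abbrev Words (ι : Type*) (k : ℕ) : Type _ := {α : FreeMonoid ι // α.length = k}

instance {ι : Type*} [Fintype ι] (k : ℕ) : Fintype (Words ι k) :=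
  inferInstanceAs (Fintype (List.Vector ι k))

/-! ### Hilbert space tensor products -/

/-- The Hilbert space tensor product: the completion of the algebraic tensor product with
respect to the inner product `⟪x ⊗ y, x' ⊗ y'⟫ = ⟪x, x'⟫ * ⟪y, y'⟫`. -/
abbrev HTensor (E H : Type*) [NormedAddCommGroup E] [InnerProductSpace ℂ E]
    [NormedAddCommGroup H] [InnerProductSpace ℂ H] : Type _ :=
  UniformSpace.Completion (E ⊗[ℂ] H)

/-- The bounded operator `T ⊗ A` with `(T ⊗ A) (x ⊗ y) = T x ⊗ A y`. -/
def opTensor {E H : Type*} [NormedAddCommGroup E] [InnerProductSpace ℂ E]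
    [NormedAddCommGroup H] [InnerProductSpace ℂ H] (T : E →L[ℂ] E) (A : H →L[ℂ] H) :
    HTensor E H →L[ℂ] HTensor E H :=
  (TensorProduct.mapL T A).completion

theorem opTensor_tmul {E H : Type*} [NormedAddCommGroup E] [InnerProductSpace ℂ E]
    [NormedAddCommGroup H] [InnerProductSpace ℂ H] (T : E →L[ℂ] E) (A : H →L[ℂ] H)
    (x : E) (y : H) :
    opTensor T A ((x ⊗ₜ[ℂ] y : E ⊗[ℂ] H) : HTensor E H) = ((T x ⊗ₜ[ℂ] A y : E ⊗[ℂ] H) :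
      HTensor E H) := by
  simp [opTensor]

/-! ### Numerical radii -/

/-- The numerical radius `ω(T) = sup {|⟪T h, h⟫| : ‖h‖ = 1}`. -/
def numericalRadius {E : Type*} [NormedAddCommGroup E] [InnerProductSpace ℂ E]
    (T : E →L[ℂ] E) : ℝ :=
  sSup {c : ℝ | ∃ h : E, ‖h‖ = 1 ∧ c = ‖inner ℂ (T h) h‖}

theorem numericalRadius_bddAbove {E : Type*} [NormedAddCommGroup E] [InnerProductSpace ℂ E]
    (T : E →L[ℂ] E) : BddAbove {c : ℝ | ∃ h : E, ‖h‖ = 1 ∧ c = ‖inner ℂ (T h) h‖} := by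
  refine ⟨‖T‖, ?_⟩
  rintro c ⟨h, hh, rfl⟩
  have h1 := norm_inner_le_norm (𝕜 := ℂ) (T h) h
  have h2 := T.le_opNorm h
  rw [hh, mul_one] at h1 h2
  exact h1.trans h2

/-- The joint numerical radius `w(X_i : i ∈ ι) = ω(∑ i, S_i ⊗ X_i^*)` of a finite family of
bounded operators, where the `S_i` are the left creation operators on the full Fock space with
one generator for each member of the family. -/
def jointNumericalRadius {ι H : Type*} [Fintype ι] [NormedAddCommGroup H]
    [InnerProductSpace ℂ H] [CompleteSpace H] (X : ι → H →L[ℂ] H) : ℝ :=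
  numericalRadius (∑ i, opTensor (creation i) (ContinuousLinearMap.adjoint (X i)) :
    HTensor (Fock ι) H →L[ℂ] HTensor (Fock ι) H)

/-! ### Selfadjoint harmonic polynomials -/

/-- The polynomial `F(S_1, …, S_n) = (1/2) I ⊗ A_0 + ∑_{1 ≤ |α| ≤ m - 1} S_α ⊗ A_α`.
Only the coefficients with `|α| ≤ m - 1` matter. -/
def analyticPoly {n : ℕ} {H : Type*} [NormedAddCommGroup H] [InnerProductSpace ℂ H]
    (m : ℕ) (A : FreeMonoid (Fin n) → H →L[ℂ] H) :
    HTensor (Fock (Fin n)) H →L[ℂ] HTensor (Fock (Fin n)) H :=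
  (1 / 2 : ℂ) • opTensor (ContinuousLinearMap.id ℂ (Fock (Fin n))) (A 1) +
    ∑ k ∈ Finset.Icc 1 (m - 1), ∑ α : Words (Fin n) k,
      opTensor (wordProd creation (α : FreeMonoid (Fin n))) (A α)

/-- The selfadjoint harmonic polynomial `H_A(S_1, …, S_n) = Re F(S_1, …, S_n)`, where
`Re T = (T + T^*) / 2`. -/
def harmonicPoly {n : ℕ} {H : Type*} [NormedAddCommGroup H] [InnerProductSpace ℂ H]
    (m : ℕ) (A : FreeMonoid (Fin n) → H →L[ℂ] H) :
    HTensor (Fock (Fin n)) H →L[ℂ] HTensor (Fock (Fin n)) H :=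
  (1 / 2 : ℂ) • (analyticPoly m A + ContinuousLinearMap.adjoint (analyticPoly m A))

/-! ### The radius `t_m` -/

/-- The number `cos (π / ([(m - 1) / k] + 2))`, where `[x]` is the integer part of `x`
(the quotient is the integer division of natural numbers). -/
def fejerConst (m k : ℕ) : ℝ := Real.cos (Real.pi / ((((m - 1) / k : ℕ) : ℝ) + 2))

/-- `t` lies in `(0, 1]` and solves
`∑_{k=1}^{m-1} t^k cos (π / ([(m - 1) / k] + 2)) = 1 / 2`. -/
def IsBohrRadius (m : ℕ) (t : ℝ) : Prop :=
  t ∈ Set.Ioc (0 : ℝ) 1 ∧ ∑ k ∈ Finset.Icc 1 (m - 1), t ^ k * fejerConst m k = 1 / 2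

end NCHarmonic

end

/-!
For `|z| = 1` the gauge isometry `Γ_z e_α = z ^ |α| e_α` of the Fock space multiplies the degree `k`
part `T_k = ∑_{|α| = k} S_α ⊗ C_α` of the polynomial with coefficients `C = B - A` by `z ^ k` in
quadratic forms. Evaluating `H_C ≥ 0` at the vectors `(Γ_z ⊗ I) x`, `‖x‖ = 1`, thus gives a
nonnegative trigonometric polynomial in `z` with constant term at most `‖C_0‖ / 2` and coefficients
`⟪T_k x, x⟫`, and Fejér's coefficient estimate bounds `ω(T_k)`. Words in the alphabet `{|α| = k}`
concatenate injectively, so a copy of the full Fock space over that alphabet sits isometrically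
inside the Fock space, with creation operators the restrictions of the `S_α`; this bounds the joint
numerical radius of the `C_α^*`, `|α| = k`, by `ω(T_k)`. The second inequality is the sum of the
resulting triangle inequalities with the weights `r ^ k ≤ t ^ k`, by the choice of `t = t_m`.
-/

noncomputable section

namespace NCHarmonic

section Fejer

/-- The `j`-th of `L` equally spaced points on the unit circle, starting at `exp (i φ)`. -/
def equispaced (L : ℕ) (φ : ℝ) (j : ℕ) : Circle :=
  Circle.exp (φ + 2 * Real.pi * j / L)

/-- The real trigonometric polynomial `a + Re ∑_{p=1}^N f_p z ^ p` on the unit circle. Every real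
trigonometric polynomial of degree at most `N` has this form, with `p`-th Fourier coefficient
`f p / 2` for `p ≥ 1`. -/
def trigPoly (N : ℕ) (a : ℝ) (f : ℕ → ℂ) (z : Circle) : ℝ :=
  a + (∑ p ∈ Finset.Icc 1 N, (z : ℂ) ^ p * f p).re

theorem sum_equispaced_zpow {L : ℕ} (φ : ℝ) {p : ℤ} (hp : ¬ (L : ℤ) ∣ p) :
    ∑ j ∈ Finset.range L, (equispaced L φ j : ℂ) ^ p = 0 := by
  rcases Nat.eq_zero_or_pos L with rfl | hL
  · rw [Finset.range_zero, Finset.sum_empty]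
  have hζ := Complex.isPrimitiveRoot_exp L hL.ne'
  set ζ := Complex.exp (2 * Real.pi * Complex.I / L) with hζ_def
  have equispaced_eq (j : ℕ) : (equispaced L φ j : ℂ) = Circle.exp φ * ζ ^ j := by
    rw [equispaced, Circle.exp_add, Circle.coe_mul, Circle.coe_exp (_ / _), hζ_def,
      ← Complex.exp_nat_mul]
    congr 2
    push_cast
    ring
  have zpow_ne_one : ζ ^ p ≠ 1 := fun h => hp ((hζ.zpow_eq_one_iff_dvd p).1 h)
  have pow_eq_one : (ζ ^ p) ^ L = 1 := by
    rw [← zpow_natCast, zpow_comm, zpow_natCast, hζ.pow_eq_one, one_zpow]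
  calc ∑ j ∈ Finset.range L, (equispaced L φ j : ℂ) ^ p
      = ∑ j ∈ Finset.range L, (Circle.exp φ : ℂ) ^ p * (ζ ^ p) ^ j := by
        refine Finset.sum_congr rfl fun j _ => ?_
        rw [equispaced_eq, mul_zpow, ← zpow_natCast, ← zpow_natCast, zpow_comm]
    _ = 0 := by
        rw [← Finset.mul_sum, geom_sum_eq zpow_ne_one, pow_eq_one, sub_self, zero_div, mul_zero]

theorem sum_equispaced_pow {L : ℕ} (φ : ℝ) {p : ℕ} (hp : 1 ≤ p) (hpL : p < L) :
    ∑ j ∈ Finset.range L, (equispaced L φ j : ℂ) ^ p = 0 := by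
  have h : ¬ (L : ℤ) ∣ p := Int.natCast_dvd_natCast.not.2 (Nat.not_dvd_of_pos_of_lt hp hpL)
  simpa only [zpow_natCast] using sum_equispaced_zpow φ h

theorem ofReal_re_circle_pow (z : Circle) (k : ℕ) :
    (((z : ℂ) ^ k).re : ℂ) = ((z : ℂ) ^ k + (z : ℂ) ^ (-k : ℤ)) / 2 := by
  rw [Complex.re_eq_add_conj, zpow_neg, zpow_natCast, ← Circle.coe_pow, ← Circle.coe_inv,
    Circle.coe_inv_eq_conj]

theorem sum_equispaced_re_pow_mul_pow {L k p : ℕ} (φ : ℝ) (hp : 1 ≤ p) (hpL : p + k < L) :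
    ∑ j ∈ Finset.range L, (((equispaced L φ j : ℂ) ^ k).re : ℂ) * (equispaced L φ j : ℂ) ^ p =
      if p = k then (L : ℂ) / 2 else 0 := by
  have product_to_sum (z : Circle) : (((z : ℂ) ^ k).re : ℂ) * (z : ℂ) ^ p =
      ((z : ℂ) ^ (p + k) + (z : ℂ) ^ ((p : ℤ) - k)) / 2 := by
    rw [ofReal_re_circle_pow, sub_eq_add_neg, zpow_add₀ z.coe_ne_zero, zpow_natCast, pow_add]
    ring
  simp_rw [product_to_sum]
  rw [← Finset.sum_div, Finset.sum_add_distrib, sum_equispaced_pow φ (by omega) hpL, zero_add]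
  split_ifs with hpk
  · simp [hpk]
  · have not_dvd : ¬ (L : ℤ) ∣ (p : ℤ) - k := fun hd =>
      hpk (by have := Int.eq_zero_of_abs_lt_dvd hd (by rw [abs_lt]; omega); omega)
    rw [sum_equispaced_zpow φ not_dvd, zero_div]

theorem sum_trigPoly_equispaced {L N : ℕ} (φ : ℝ) (hL : N < L) (a : ℝ) (f : ℕ → ℂ) :
    ∑ j ∈ Finset.range L, trigPoly N a f (equispaced L φ j) = L * a := by
  have sum_eq_zero : ∑ j ∈ Finset.range L, ∑ p ∈ Finset.Icc 1 N,
      (equispaced L φ j : ℂ) ^ p * f p = 0 := by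
    rw [Finset.sum_comm]
    refine Finset.sum_eq_zero fun p hp => ?_
    obtain ⟨hp1, hpN⟩ := Finset.mem_Icc.1 hp
    rw [← Finset.sum_mul, sum_equispaced_pow φ hp1 (by omega), zero_mul]
  simp only [trigPoly, Finset.sum_add_distrib, ← Complex.re_sum, sum_eq_zero, Finset.sum_const,
    Finset.card_range, nsmul_eq_mul, Complex.zero_re, add_zero]

theorem sum_re_pow_mul_trigPoly_equispaced {L N k : ℕ} (φ : ℝ) (hk : 1 ≤ k) (hkN : k ≤ N)
    (hL : N + k < L) (a : ℝ) (f : ℕ → ℂ) :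
    ∑ j ∈ Finset.range L, ((equispaced L φ j : ℂ) ^ k).re * trigPoly N a f (equispaced L φ j) =
      L / 2 * (f k).re := by
  have constant_term : ∑ j ∈ Finset.range L, ((equispaced L φ j : ℂ) ^ k).re = 0 := by
    rw [← Complex.re_sum, sum_equispaced_pow φ hk (by omega), Complex.zero_re]
  have higher_terms : ∑ j ∈ Finset.range L, (((equispaced L φ j : ℂ) ^ k).re : ℂ) *
      ∑ p ∈ Finset.Icc 1 N, (equispaced L φ j : ℂ) ^ p * f p = (L / 2 : ℝ) * f k := by
    simp_rw [Finset.mul_sum, ← mul_assoc]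
    rw [Finset.sum_comm]
    simp_rw [← Finset.sum_mul]
    calc ∑ p ∈ Finset.Icc 1 N, (∑ j ∈ Finset.range L,
            (((equispaced L φ j : ℂ) ^ k).re : ℂ) * (equispaced L φ j : ℂ) ^ p) * f p
        = ∑ p ∈ Finset.Icc 1 N, if p = k then (L : ℂ) / 2 * f p else 0 := by
          refine Finset.sum_congr rfl fun p hp => ?_
          obtain ⟨hp1, hpN⟩ := Finset.mem_Icc.1 hp
          rw [sum_equispaced_re_pow_mul_pow φ hp1 (by omega), ite_mul, zero_mul]
      _ = (L / 2 : ℝ) * f k := by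
          rw [Finset.sum_ite_eq' _ _ _, if_pos (Finset.mem_Icc.2 ⟨hk, hkN⟩)]
          push_cast
          rfl
  simp_rw [trigPoly, mul_add, Finset.sum_add_distrib, ← Finset.sum_mul, constant_term, zero_mul,
    zero_add, ← Complex.re_ofReal_mul, ← Complex.re_sum, higher_terms]

theorem cos_le_cos_of_le_of_le_two_pi_sub {x y : ℝ} (hx : 0 ≤ x) (hxy : x ≤ y)
    (hy : y ≤ 2 * Real.pi - x) : Real.cos y ≤ Real.cos x := by
  rcases le_total y Real.pi with h | h
  · exact Real.cos_le_cos_of_nonneg_of_le_pi hx h hxy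
  · rw [← Real.cos_two_pi_sub]
    exact Real.cos_le_cos_of_nonneg_of_le_pi hx (by linarith) (by linarith)

theorem cos_add_two_pi_mul_mod_div {q : ℕ} (hq : q ≠ 0) (x : ℝ) (j : ℕ) :
    Real.cos (x + 2 * Real.pi * (j % q : ℕ) / q) = Real.cos (x + 2 * Real.pi * j / q) := by
  have hq' : (q : ℝ) ≠ 0 := Nat.cast_ne_zero.2 hq
  have hj : (j : ℝ) = q * (j / q : ℕ) + (j % q : ℕ) := by exact_mod_cast (Nat.div_add_mod j q).symm
  rw [← Real.cos_add_nat_mul_two_pi _ (j / q), hj]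
  congr 1
  field_simp
  ring

theorem cos_pi_div_add_two_pi_mul_div_le {q : ℕ} (hq : 0 < q) (j : ℕ) :
    Real.cos (Real.pi / q + 2 * Real.pi * j / q) ≤ Real.cos (Real.pi / q) := by
  have hq' : (0 : ℝ) < q := Nat.cast_pos.2 hq
  have hπ := Real.pi_pos
  rw [← cos_add_two_pi_mul_mod_div hq.ne']
  have hj : ((j % q : ℕ) : ℝ) + 1 ≤ q := by exact_mod_cast Nat.mod_lt j hq
  refine cos_le_cos_of_le_of_le_two_pi_sub (by positivity)
    (le_add_of_nonneg_right (by positivity)) ?_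
  rw [le_sub_iff_add_le, ← add_div, ← add_div, div_le_iff₀ hq']
  nlinarith

theorem re_equispaced_pow_le {k q : ℕ} (hk : 0 < k) (hq : 0 < q) (j : ℕ) :
    ((equispaced (k * q) (Real.pi / (k * q : ℕ)) j : ℂ) ^ k).re ≤ Real.cos (Real.pi / q) := by
  have angle : (k : ℝ) * (Real.pi / (k * q : ℕ) + 2 * Real.pi * j / (k * q : ℕ)) =
      Real.pi / q + 2 * Real.pi * j / q := by
    push_cast
    field_simp
  rw [equispaced, ← Circle.coe_pow, ← Circle.exp_natCast_mul, angle, Circle.coe_exp,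
    Complex.exp_ofReal_mul_I_re]
  exact cos_pi_div_add_two_pi_mul_div_le hq j

/-- Evaluating the polynomial at the `L`-th roots of `-1`, where `L = k ([N / k] + 2)`, with the
weights `cos (π / ([N / k] + 2)) - Re (z ^ k)`, which are nonnegative there, isolates the constant
term and the `k`-th coefficient because `N + k < L`. -/
theorem re_coeff_le_of_trigPoly_nonneg {N k : ℕ} (hk : 1 ≤ k) (hkN : k ≤ N) {a : ℝ} {f : ℕ → ℂ}
    (hpos : ∀ z, 0 ≤ trigPoly N a f z) :
    (f k).re ≤ 2 * a * Real.cos (Real.pi / ((N / k : ℕ) + 2)) := by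
  set q := N / k + 2 with hq
  set L := k * q with hL
  set c := Real.cos (Real.pi / q) with hc
  let z : ℕ → Circle := equispaced L (Real.pi / L)
  have hNL : N + k < L := by
    have := Nat.lt_mul_div_succ N hk
    rw [hL, hq]
    linarith
  have weighted_sum : 0 ≤ L * (c * a - (f k).re / 2) := calc
    0 ≤ ∑ j ∈ Finset.range L, (c - ((z j : ℂ) ^ k).re) * trigPoly N a f (z j) :=
      Finset.sum_nonneg fun j _ =>
        mul_nonneg (sub_nonneg.2 (re_equispaced_pow_le hk (Nat.succ_pos _) j)) (hpos _)
    _ = L * (c * a - (f k).re / 2) := by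
      simp_rw [sub_mul, Finset.sum_sub_distrib, ← Finset.mul_sum, z]
      rw [sum_trigPoly_equispaced _ (by omega), sum_re_pow_mul_trigPoly_equispaced _ hk hkN hNL]
      ring
  have hL_pos : (0 : ℝ) < L := Nat.cast_pos.2 (by omega)
  have hc' : Real.cos (Real.pi / ((N / k : ℕ) + 2)) = c := by
    rw [hc, hq]
    push_cast
    rfl
  rw [hc']
  linarith [nonneg_of_mul_nonneg_right weighted_sum hL_pos]

theorem exists_circle_pow_mul_eq_norm {k : ℕ} (hk : k ≠ 0) (w : ℂ) :
    ∃ u : Circle, (u : ℂ) ^ k * w = ‖w‖ := by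
  refine ⟨Circle.exp (-(Complex.arg w / k)), ?_⟩
  rw [← Circle.coe_pow, ← Circle.exp_natCast_mul, mul_neg,
    mul_div_cancel₀ _ (Nat.cast_ne_zero.2 hk), Circle.exp_neg, Circle.coe_inv, Circle.coe_exp,
    inv_mul_eq_iff_eq_mul₀ (Complex.exp_ne_zero _), mul_comm, Complex.norm_mul_exp_arg_mul_I]

theorem norm_coeff_le_of_trigPoly_nonneg {N k : ℕ} (hk : 1 ≤ k) (hkN : k ≤ N) {a : ℝ} {f : ℕ → ℂ}
    (hpos : ∀ z, 0 ≤ trigPoly N a f z) :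
    ‖f k‖ ≤ 2 * a * Real.cos (Real.pi / ((N / k : ℕ) + 2)) := by
  obtain ⟨u, hu⟩ := exists_circle_pow_mul_eq_norm (by omega : k ≠ 0) (f k)
  have rotated_nonneg (z : Circle) : 0 ≤ trigPoly N a (fun p => (u : ℂ) ^ p * f p) z := by
    simpa only [trigPoly, Circle.coe_mul, mul_pow, mul_assoc] using hpos (z * u)
  simpa only [hu, Complex.ofReal_re] using re_coeff_le_of_trigPoly_nonneg hk hkN rotated_nonneg

end Fejer

section BohrRadius

theorem strictMonoOn_sum_pow_mul {s : Finset ℕ} {c : ℕ → ℝ} (hs : 0 ∉ s) (hc : ∀ k ∈ s, 0 < c k)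
    (hne : s.Nonempty) : StrictMonoOn (fun t : ℝ => ∑ k ∈ s, t ^ k * c k) (Set.Ici 0) :=
  fun _ hx _ _ hxy => Finset.sum_lt_sum_of_nonempty hne fun k hk =>
    mul_lt_mul_of_pos_right (pow_lt_pow_left₀ hxy hx (ne_of_mem_of_not_mem hk hs)) (hc k hk)

theorem existsUnique_sum_pow_mul_eq {s : Finset ℕ} {c : ℕ → ℝ} {b : ℝ} (hs : 0 ∉ s)
    (hc : ∀ k ∈ s, 0 < c k) (hb : 0 < b) (hbc : b ≤ ∑ k ∈ s, c k) :
    ∃! t : ℝ, t ∈ Set.Ioc (0 : ℝ) 1 ∧ ∑ k ∈ s, t ^ k * c k = b := by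
  have hne : s.Nonempty := Finset.nonempty_of_sum_ne_zero (hb.trans_le hbc).ne'
  have value_zero : ∑ k ∈ s, (0 : ℝ) ^ k * c k = 0 := Finset.sum_eq_zero fun k hk => by
    rw [zero_pow (ne_of_mem_of_not_mem hk hs), zero_mul]
  have value_one : ∑ k ∈ s, (1 : ℝ) ^ k * c k = ∑ k ∈ s, c k := by
    simp only [one_pow, one_mul]
  obtain ⟨t, ht, ht_eq⟩ : b ∈ (fun t : ℝ => ∑ k ∈ s, t ^ k * c k) '' Set.Ioc 0 1 :=
    intermediate_value_Ioc zero_le_one (Continuous.continuousOn (by fun_prop))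
      ⟨value_zero.trans_lt hb, hbc.trans_eq value_one.symm⟩
  exact ⟨t, ⟨ht, ht_eq⟩, fun u hu => (strictMonoOn_sum_pow_mul hs hc hne).injOn
    (Set.mem_Ici.2 hu.1.1.le) (Set.mem_Ici.2 ht.1.le) (hu.2.trans ht_eq.symm)⟩

theorem fejerConst_nonneg (m k : ℕ) : 0 ≤ fejerConst m k := by
  refine Real.cos_nonneg_of_neg_pi_div_two_le_of_le
    ((neg_nonpos.2 (by positivity)).trans (by positivity)) ?_
  gcongr
  exact le_add_of_nonneg_left (Nat.cast_nonneg _)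

theorem half_le_fejerConst {m k : ℕ} (hk : 1 ≤ k) (hkm : k ≤ m - 1) : 1 / 2 ≤ fejerConst m k := by
  have hdiv : (1 : ℝ) ≤ ((m - 1) / k : ℕ) := by exact_mod_cast (Nat.one_le_div_iff hk).2 hkm
  have hπ := Real.pi_pos
  rw [fejerConst, ← Real.cos_pi_div_three]
  refine Real.cos_le_cos_of_nonneg_of_le_pi (by positivity) (by linarith) ?_
  gcongr
  linarith

theorem existsUnique_isBohrRadius {m : ℕ} (hm : 2 ≤ m) : ∃! t : ℝ, IsBohrRadius m t := by
  have fejerConst_pos : ∀ k ∈ Finset.Icc 1 (m - 1), 0 < fejerConst m k := fun k hk =>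
    one_half_pos.trans_le (half_le_fejerConst (Finset.mem_Icc.1 hk).1 (Finset.mem_Icc.1 hk).2)
  have half_le_sum : 1 / 2 ≤ ∑ k ∈ Finset.Icc 1 (m - 1), fejerConst m k :=
    (half_le_fejerConst le_rfl (by omega)).trans (Finset.single_le_sum
      (fun k hk => (fejerConst_pos k hk).le) (Finset.mem_Icc.2 ⟨le_rfl, by omega⟩))
  exact existsUnique_sum_pow_mul_eq (by simp) fejerConst_pos one_half_pos half_le_sum

end BohrRadius

section Fock

variable {ι E : Type*} [NormedAddCommGroup E] [InnerProductSpace ℂ E]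

theorem fock_ext {f g : Fock ι →L[ℂ] E} (h : ∀ α, f (fockBasis α) = g (fockBasis α)) : f = g := by
  classical
  refine lp.ext_continuousLinearMap (by norm_num) fun α => ?_
  ext
  convert! h α

theorem wordProd_creation_fockBasis (α β : FreeMonoid ι) :
    wordProd creation α (fockBasis β) = fockBasis (α * β) := by
  induction α using FreeMonoid.recOn with
  | one => simp [wordProd]
  | of_mul i α ih =>
    rw [wordProd] at ih ⊢
    rw [map_mul, FreeMonoid.lift_eval_of, mul_apply_eq_comp, ih, creation_fockBasis, mul_assoc]

/-- The isometry of the Fock space that maps the basis `e_α` to a given orthonormal family. -/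
def fockLift [CompleteSpace E] {v : FreeMonoid ι → E} (hv : Orthonormal ℂ v) : Fock ι →ₗᵢ[ℂ] E :=
  hv.orthogonalFamily.linearIsometry

theorem fockLift_fockBasis [CompleteSpace E] {v : FreeMonoid ι → E} (hv : Orthonormal ℂ v)
    (α : FreeMonoid ι) : fockLift hv (fockBasis α) = v α := by
  classical
  have h := hv.orthogonalFamily.linearIsometry_apply_single (i := α) (1 : ℂ)
  rwa [LinearIsometry.toSpanSingleton_apply, one_smul] at h

theorem orthonormal_circle_pow_smul_fockBasis (z : Circle) :
    Orthonormal ℂ (fun α : FreeMonoid ι => (z : ℂ) ^ α.length • (fockBasis α : Fock ι)) := by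
  refine ⟨fun α => ?_, fun α β hαβ => ?_⟩
  · rw [norm_smul, norm_pow, Circle.norm_coe, one_pow, one_mul, (fockBasis_orthonormal ι).1]
  · change inner ℂ _ _ = _
    rw [inner_smul_left, inner_smul_right, (fockBasis_orthonormal ι).2 hαβ, mul_zero, mul_zero]

/-- The gauge isometry `e_α ↦ z ^ |α| e_α` of the Fock space. -/
def gauge (ι : Type*) (z : Circle) : Fock ι →ₗᵢ[ℂ] Fock ι :=
  fockLift (orthonormal_circle_pow_smul_fockBasis z)

theorem gauge_fockBasis (z : Circle) (α : FreeMonoid ι) :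
    gauge ι z (fockBasis α) = (z : ℂ) ^ α.length • (fockBasis α : Fock ι) :=
  fockLift_fockBasis _ _

theorem wordProd_creation_gauge (z : Circle) (α : FreeMonoid ι) (x : Fock ι) :
    wordProd creation α (gauge ι z x) =
      ((z⁻¹ : Circle) : ℂ) ^ α.length • gauge ι z (wordProd creation α x) := by
  suffices wordProd creation α ∘L (gauge ι z).toContinuousLinearMap =
      ((z⁻¹ : Circle) : ℂ) ^ α.length •
        ((gauge ι z).toContinuousLinearMap ∘L wordProd creation α) from congr($this x)
  refine fock_ext fun β => ?_
  simp only [smul_apply, ContinuousLinearMap.comp_apply,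
    LinearIsometry.coe_toContinuousLinearMap, gauge_fockBasis, map_smul,
    wordProd_creation_fockBasis, smul_smul, FreeMonoid.length_mul, pow_add, Circle.coe_inv,
    inv_pow, inv_mul_cancel_left₀ (pow_ne_zero _ z.coe_ne_zero)]

/-- Concatenation of words of length `k`. -/
def wordsFlatten (ι : Type*) (k : ℕ) : FreeMonoid (Words ι k) →* FreeMonoid ι :=
  FreeMonoid.lift Subtype.val

theorem wordsFlatten_of {k : ℕ} (α : Words ι k) : wordsFlatten ι k (FreeMonoid.of α) = α :=
  FreeMonoid.lift_eval_of _ _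

theorem length_wordsFlatten {k : ℕ} (α : FreeMonoid (Words ι k)) :
    (wordsFlatten ι k α).length = α.length * k := by
  induction α using FreeMonoid.recOn with
  | one => simp
  | of_mul i α ih =>
    rw [map_mul, FreeMonoid.length_mul, FreeMonoid.length_mul, ih, wordsFlatten_of, i.2,
      FreeMonoid.length_of, add_mul, one_mul]

theorem wordsFlatten_injective {k : ℕ} (hk : k ≠ 0) : Function.Injective (wordsFlatten ι k) := by
  intro α β h
  have hlength : α.length = β.length := by
    rw [← Nat.mul_left_inj hk, ← length_wordsFlatten, ← length_wordsFlatten, h]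
  induction α using FreeMonoid.recOn generalizing β with
  | one => exact (FreeMonoid.length_eq_zero.1 hlength.symm).symm
  | of_mul i α ih =>
    cases β using FreeMonoid.casesOn with
    | one => simp at hlength
    | of_mul j β =>
      rw [map_mul, map_mul, wordsFlatten_of, wordsFlatten_of] at h
      obtain ⟨hhead, htail⟩ := List.append_inj (s₁ := (i : FreeMonoid ι).toList)
        (s₂ := (j : FreeMonoid ι).toList) h (i.2.trans j.2.symm)
      rw [ih htail (by simpa using hlength), Subtype.ext (a1 := i) (a2 := j) hhead]

/-- The isometry `e_{(α₁, …, αⱼ)} ↦ e_{α₁ ⋯ αⱼ}` from the Fock space over the alphabet of words of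
length `k`. It intertwines the creation operators of that Fock space with the products `S_α`,
`|α| = k`. -/
def regroup (ι : Type*) {k : ℕ} (hk : k ≠ 0) : Fock (Words ι k) →ₗᵢ[ℂ] Fock ι :=
  fockLift ((fockBasis_orthonormal ι).comp _ (wordsFlatten_injective hk))

theorem regroup_fockBasis {k : ℕ} (hk : k ≠ 0) (α : FreeMonoid (Words ι k)) :
    regroup ι hk (fockBasis α) = fockBasis (wordsFlatten ι k α) :=
  fockLift_fockBasis _ _

theorem wordProd_creation_regroup {k : ℕ} (hk : k ≠ 0) (α : Words ι k) (x : Fock (Words ι k)) :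
    wordProd creation (α : FreeMonoid ι) (regroup ι hk x) = regroup ι hk (creation α x) := by
  suffices wordProd creation (α : FreeMonoid ι) ∘L (regroup ι hk).toContinuousLinearMap =
      (regroup ι hk).toContinuousLinearMap ∘L creation α from congr($this x)
  refine fock_ext fun β => ?_
  simp only [ContinuousLinearMap.comp_apply, LinearIsometry.coe_toContinuousLinearMap,
    regroup_fockBasis, wordProd_creation_fockBasis, creation_fockBasis, map_mul, wordsFlatten_of]

end Fock

section Tensor

variable {E F G H : Type*} [NormedAddCommGroup E] [InnerProductSpace ℂ E]
  [NormedAddCommGroup F] [InnerProductSpace ℂ F] [NormedAddCommGroup G] [InnerProductSpace ℂ G]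
  [NormedAddCommGroup H] [InnerProductSpace ℂ H]

theorem hTensor_ext {f g : HTensor E H →L[ℂ] G}
    (h : ∀ x y, f ((x ⊗ₜ[ℂ] y : E ⊗[ℂ] H) : HTensor E H) =
      g ((x ⊗ₜ[ℂ] y : E ⊗[ℂ] H) : HTensor E H)) : f = g := by
  ext x
  induction x using UniformSpace.Completion.induction_on with
  | hp => exact isClosed_eq f.continuous g.continuous
  | ih x =>
    induction x using TensorProduct.induction_on with
    | zero => rw [UniformSpace.Completion.coe_zero, map_zero, map_zero]
    | tmul x y => exact h x y
    | add x y hx hy => rw [UniformSpace.Completion.coe_add, map_add, map_add, hx, hy]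

theorem opTensor_add (T : E →L[ℂ] E) (A B : H →L[ℂ] H) :
    opTensor T (A + B) = opTensor T A + opTensor T B :=
  hTensor_ext fun x y => by
    simp only [add_apply, opTensor_tmul, TensorProduct.tmul_add, UniformSpace.Completion.coe_add]

theorem opTensor_smul (T : E →L[ℂ] E) (c : ℂ) (A : H →L[ℂ] H) :
    opTensor T (c • A) = c • opTensor T A :=
  hTensor_ext fun x y => by
    simp only [smul_apply, opTensor_tmul, TensorProduct.tmul_smul, UniformSpace.Completion.coe_smul]

theorem opTensor_sub (T : E →L[ℂ] E) (A B : H →L[ℂ] H) :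
    opTensor T (A - B) = opTensor T A - opTensor T B :=
  hTensor_ext fun x y => by
    simp only [sub_apply, opTensor_tmul, TensorProduct.tmul_sub, UniformSpace.Completion.coe_sub]

theorem norm_opTensor_le (T : E →L[ℂ] E) (A : H →L[ℂ] H) : ‖opTensor T A‖ ≤ ‖T‖ * ‖A‖ := by
  refine ContinuousLinearMap.opNorm_le_bound _ (by positivity) fun x => ?_
  induction x using UniformSpace.Completion.induction_on with
  | hp => exact isClosed_le (by fun_prop) (by fun_prop)
  | ih x =>
    rw [opTensor, ContinuousLinearMap.completion_apply_coe, UniformSpace.Completion.norm_coe,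
      UniformSpace.Completion.norm_coe]
    exact (TensorProduct.mapL T A).le_of_opNorm_le (TensorProduct.norm_mapL_le T A) x

theorem adjoint_opTensor [CompleteSpace E] [CompleteSpace H] (T : E →L[ℂ] E) (A : H →L[ℂ] H) :
    ContinuousLinearMap.adjoint (opTensor T A) =
      opTensor (ContinuousLinearMap.adjoint T) (ContinuousLinearMap.adjoint A) := by
  refine hTensor_ext fun x y => ext_inner_right ℂ fun z => ?_
  rw [ContinuousLinearMap.adjoint_inner_left, opTensor_tmul]
  suffices innerSL ℂ ((x ⊗ₜ[ℂ] y : E ⊗[ℂ] H) : HTensor E H) ∘L opTensor T A =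
      innerSL ℂ ((ContinuousLinearMap.adjoint T x ⊗ₜ[ℂ] ContinuousLinearMap.adjoint A y :
        E ⊗[ℂ] H) : HTensor E H) from congr($this z)
  refine hTensor_ext fun u v => ?_
  simp only [ContinuousLinearMap.comp_apply, innerSL_apply_apply, opTensor_tmul,
    UniformSpace.Completion.inner_coe, TensorProduct.inner_tmul,
    ContinuousLinearMap.adjoint_inner_left]

/-- The operator `W ⊗ I` for an isometry `W`. -/
def isometryTensor (H : Type*) [NormedAddCommGroup H] [InnerProductSpace ℂ H] (W : E →ₗᵢ[ℂ] F) :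
    HTensor E H →ₗᵢ[ℂ] HTensor F H where
  toLinearMap := (W.rTensor H).toContinuousLinearMap.completion
  norm_map' x := by
    induction x using UniformSpace.Completion.induction_on with
    | hp =>
      exact isClosed_eq
        (W.rTensor H).toContinuousLinearMap.completion.continuous.norm continuous_norm
    | ih x => simpa using (W.rTensor H).norm_map x

theorem isometryTensor_tmul (W : E →ₗᵢ[ℂ] F) (x : E) (y : H) :
    isometryTensor H W ((x ⊗ₜ[ℂ] y : E ⊗[ℂ] H) : HTensor E H) =
      ((W x ⊗ₜ[ℂ] y : F ⊗[ℂ] H) : HTensor F H) := by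
  simp [isometryTensor]

theorem opTensor_isometryTensor {W : E →ₗᵢ[ℂ] F} {T : F →L[ℂ] F} {T' : E →L[ℂ] E} {c : ℂ}
    (h : ∀ x, T (W x) = c • W (T' x)) (A : H →L[ℂ] H) (x : HTensor E H) :
    opTensor T A (isometryTensor H W x) = c • isometryTensor H W (opTensor T' A x) := by
  suffices opTensor T A ∘L (isometryTensor H W).toContinuousLinearMap =
      c • ((isometryTensor H W).toContinuousLinearMap ∘L opTensor T' A) from congr($this x)
  refine hTensor_ext fun x y => ?_
  simp only [smul_apply, ContinuousLinearMap.comp_apply, LinearIsometry.coe_toContinuousLinearMap,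
    isometryTensor_tmul, opTensor_tmul, h, ← UniformSpace.Completion.coe_smul,
    TensorProduct.smul_tmul']

end Tensor

section NumericalRadius

variable {E F : Type*} [NormedAddCommGroup E] [InnerProductSpace ℂ E]
  [NormedAddCommGroup F] [InnerProductSpace ℂ F]

theorem numericalRadius_le {T : E →L[ℂ] E} {c : ℝ} (hc : 0 ≤ c)
    (h : ∀ x, ‖x‖ = 1 → ‖inner ℂ (T x) x‖ ≤ c) : numericalRadius T ≤ c :=
  Real.sSup_le (by rintro _ ⟨x, hx, rfl⟩; exact h x hx) hc

theorem norm_inner_le_numericalRadius (T : E →L[ℂ] E) {x : E} (hx : ‖x‖ = 1) :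
    ‖inner ℂ (T x) x‖ ≤ numericalRadius T :=
  le_csSup (numericalRadius_bddAbove T) ⟨x, hx, rfl⟩

theorem numericalRadius_nonneg (T : E →L[ℂ] E) : 0 ≤ numericalRadius T :=
  Real.sSup_nonneg (by rintro _ ⟨x, _, rfl⟩; exact norm_nonneg _)

theorem numericalRadius_sub_le (S T : E →L[ℂ] E) :
    numericalRadius (S - T) ≤ numericalRadius S + numericalRadius T := by
  refine numericalRadius_le (add_nonneg (numericalRadius_nonneg S) (numericalRadius_nonneg T))
    fun x hx => ?_
  rw [sub_apply, inner_sub_left]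
  exact (norm_sub_le _ _).trans
    (add_le_add (norm_inner_le_numericalRadius S hx) (norm_inner_le_numericalRadius T hx))

theorem numericalRadius_le_of_intertwining (W : E →ₗᵢ[ℂ] F) {S : E →L[ℂ] E} {T : F →L[ℂ] F}
    (h : ∀ x, T (W x) = W (S x)) : numericalRadius S ≤ numericalRadius T := by
  refine numericalRadius_le (numericalRadius_nonneg T) fun x hx => ?_
  rw [← W.inner_map_map, ← h]
  exact norm_inner_le_numericalRadius T ((W.norm_map x).trans hx)

theorem jointNumericalRadius_sub_le {ι : Type*} [Fintype ι] [CompleteSpace E]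
    (X Y : ι → E →L[ℂ] E) :
    jointNumericalRadius (fun i => X i - Y i) ≤
      jointNumericalRadius X + jointNumericalRadius Y := by
  simp only [jointNumericalRadius, map_sub, opTensor_sub, Finset.sum_sub_distrib]
  exact numericalRadius_sub_le _ _

theorem re_inner_realPart_apply [CompleteSpace E] (T : E →L[ℂ] E) (x : E) :
    (inner ℂ ((realPart T : E →L[ℂ] E) x) x).re = (inner ℂ (T x) x).re := by
  rw [realPart_apply_coe, ContinuousLinearMap.star_eq_adjoint, smul_apply, add_apply,
    inner_smul_left_eq_star_smul, inner_add_left, ContinuousLinearMap.adjoint_inner_left,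
    ← inner_conj_symm x (T x), starRingEnd_apply, star_trivial, Complex.smul_re, Complex.add_re,
    Complex.conj_re, ← two_mul, smul_eq_mul, inv_mul_cancel_left₀ two_ne_zero]

end NumericalRadius

section HomogeneousPart

variable {ι H : Type*} [Fintype ι] [NormedAddCommGroup H] [InnerProductSpace ℂ H]

/-- The part `∑_{|α| = k} S_α ⊗ C_α` of degree `k` of the operator-valued power series with
coefficients `C`. -/
def homogeneousPart (C : FreeMonoid ι → H →L[ℂ] H) (k : ℕ) :
    HTensor (Fock ι) H →L[ℂ] HTensor (Fock ι) H :=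
  ∑ α : Words ι k, opTensor (wordProd creation (α : FreeMonoid ι)) (C α)

theorem homogeneousPart_zero (C : FreeMonoid ι → H →L[ℂ] H) :
    homogeneousPart C 0 = opTensor (ContinuousLinearMap.id ℂ (Fock ι)) (C 1) := by
  rw [homogeneousPart, Fintype.sum_eq_single ⟨1, FreeMonoid.length_one⟩ fun α hα =>
    absurd (Subtype.ext (FreeMonoid.length_eq_zero.1 α.2)) hα, wordProd, map_one]
  rfl

theorem inner_homogeneousPart_gauge (C : FreeMonoid ι → H →L[ℂ] H) (k : ℕ) (z : Circle)
    (x : HTensor (Fock ι) H) :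
    inner ℂ (homogeneousPart C k (isometryTensor H (gauge ι z) x))
        (isometryTensor H (gauge ι z) x) =
      (z : ℂ) ^ k * inner ℂ (homogeneousPart C k x) x := by
  have intertwining (α : Words ι k) :
      opTensor (wordProd creation (α : FreeMonoid ι)) (C α) (isometryTensor H (gauge ι z) x) =
        ((z⁻¹ : Circle) : ℂ) ^ k • isometryTensor H (gauge ι z)
          (opTensor (wordProd creation (α : FreeMonoid ι)) (C α) x) :=
    opTensor_isometryTensor (fun y => by rw [wordProd_creation_gauge, α.2]) (C α) x
  simp only [homogeneousPart, sum_apply, intertwining, ← Finset.smul_sum, ← map_sum,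
    inner_smul_left, LinearIsometry.inner_map_map, map_pow, ← Circle.coe_inv_eq_conj, inv_inv]

theorem jointNumericalRadius_adjoint_le [CompleteSpace H] (C : FreeMonoid ι → H →L[ℂ] H) {k : ℕ}
    (hk : k ≠ 0) :
    jointNumericalRadius (fun α : Words ι k => ContinuousLinearMap.adjoint (C α)) ≤
      numericalRadius (homogeneousPart C k) := by
  refine numericalRadius_le_of_intertwining (isometryTensor H (regroup ι hk)) fun x => ?_
  have intertwining (α : Words ι k) :
      opTensor (wordProd creation (α : FreeMonoid ι)) (C α) (isometryTensor H (regroup ι hk) x) =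
        isometryTensor H (regroup ι hk) (opTensor (creation α) (C α) x) :=
    (opTensor_isometryTensor (fun y => by rw [wordProd_creation_regroup, one_smul]) (C α) x).trans
      (one_smul ℂ _)
  simp only [homogeneousPart, sum_apply, intertwining, map_sum,
    ContinuousLinearMap.adjoint_adjoint]

theorem re_inner_homogeneousPart_zero_le [CompleteSpace H] (C : FreeMonoid ι → H →L[ℂ] H)
    {x : HTensor (Fock ι) H} (hx : ‖x‖ = 1) :
    (inner ℂ (homogeneousPart C 0 x) x).re ≤ ‖(realPart (C 1) : H →L[ℂ] H)‖ := by
  have realPart_opTensor_id :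
      (realPart (homogeneousPart C 0) : HTensor (Fock ι) H →L[ℂ] HTensor (Fock ι) H) =
        opTensor (ContinuousLinearMap.id ℂ (Fock ι)) (realPart (C 1) : H →L[ℂ] H) := by
    simp only [homogeneousPart_zero, realPart_apply_coe, ContinuousLinearMap.star_eq_adjoint,
      adjoint_opTensor, ContinuousLinearMap.adjoint_id, ← Complex.coe_smul, opTensor_smul,
      opTensor_add]
  rw [← re_inner_realPart_apply, realPart_opTensor_id]
  calc (inner ℂ (opTensor (ContinuousLinearMap.id ℂ (Fock ι)) (realPart (C 1) : H →L[ℂ] H) x) x).re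
      ≤ ‖opTensor (ContinuousLinearMap.id ℂ (Fock ι)) (realPart (C 1) : H →L[ℂ] H)‖ := by
        refine (Complex.re_le_norm _).trans ((norm_inner_le_norm _ _).trans ?_)
        simpa only [hx, mul_one] using ContinuousLinearMap.le_opNorm _ x
    _ ≤ ‖ContinuousLinearMap.id ℂ (Fock ι)‖ * ‖(realPart (C 1) : H →L[ℂ] H)‖ :=
        norm_opTensor_le _ _
    _ ≤ ‖(realPart (C 1) : H →L[ℂ] H)‖ :=
        mul_le_of_le_one_left (norm_nonneg _) ContinuousLinearMap.norm_id_le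

end HomogeneousPart

section HarmonicPoly

variable {H : Type*} [NormedAddCommGroup H] [InnerProductSpace ℂ H] {n m : ℕ}
  {A B C : FreeMonoid (Fin n) → H →L[ℂ] H}

theorem analyticPoly_eq (C : FreeMonoid (Fin n) → H →L[ℂ] H) :
    analyticPoly m C = (1 / 2 : ℂ) • homogeneousPart C 0 +
      ∑ k ∈ Finset.Icc 1 (m - 1), homogeneousPart C k := by
  rw [homogeneousPart_zero]
  rfl

theorem harmonicPoly_sub (A B : FreeMonoid (Fin n) → H →L[ℂ] H) :
    harmonicPoly m (A - B) = harmonicPoly m A - harmonicPoly m B := by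
  simp only [harmonicPoly, analyticPoly, Pi.sub_apply, opTensor_sub, Finset.sum_sub_distrib,
    smul_sub, smul_add, map_sub, map_add]
  abel

theorem harmonicPoly_eq_realPart (C : FreeMonoid (Fin n) → H →L[ℂ] H) :
    harmonicPoly m C = realPart (analyticPoly m C) := by
  rw [harmonicPoly, realPart_apply_coe, ContinuousLinearMap.star_eq_adjoint, ← Complex.coe_smul]
  norm_num

theorem re_inner_analyticPoly_nonneg (hC : 0 ≤ harmonicPoly m C) (x : HTensor (Fock (Fin n)) H) :
    0 ≤ (inner ℂ (analyticPoly m C x) x).re := by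
  rw [harmonicPoly_eq_realPart, ContinuousLinearMap.nonneg_iff_isPositive] at hC
  exact (hC.re_inner_nonneg_left x).trans_eq (re_inner_realPart_apply _ x)

theorem trigPoly_inner_homogeneousPart (C : FreeMonoid (Fin n) → H →L[ℂ] H) (z : Circle)
    (x : HTensor (Fock (Fin n)) H) :
    trigPoly (m - 1) ((inner ℂ (homogeneousPart C 0 x) x).re / 2)
        (fun k => inner ℂ (homogeneousPart C k x) x) z =
      (inner ℂ (analyticPoly m C (isometryTensor H (gauge (Fin n) z) x))
        (isometryTensor H (gauge (Fin n) z) x)).re := by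
  have half_smul (w : ℂ) : ((starRingEnd ℂ (1 / 2)) * w).re = w.re / 2 := by
    rw [map_div₀, map_one, map_ofNat, one_div_mul_eq_div, Complex.div_ofNat_re]
  simp only [trigPoly, analyticPoly_eq, add_apply, smul_apply, sum_apply, inner_add_left,
    inner_smul_left, sum_inner, inner_homogeneousPart_gauge, Complex.add_re, half_smul, pow_zero,
    one_mul]

variable [CompleteSpace H]

theorem numericalRadius_homogeneousPart_le (hC : 0 ≤ harmonicPoly m C) {k : ℕ} (hk : 1 ≤ k)
    (hkm : k ≤ m - 1) :
    numericalRadius (homogeneousPart C k) ≤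
      ‖(realPart (C 1) : H →L[ℂ] H)‖ * fejerConst m k := by
  refine numericalRadius_le (mul_nonneg (norm_nonneg _) (fejerConst_nonneg m k)) fun x hx => ?_
  have fejer_bound := norm_coeff_le_of_trigPoly_nonneg hk hkm fun z =>
    (re_inner_analyticPoly_nonneg hC _).trans_eq (trigPoly_inner_homogeneousPart C z x).symm
  rw [mul_div_cancel₀ _ two_ne_zero] at fejer_bound
  exact fejer_bound.trans (mul_le_mul_of_nonneg_right (re_inner_homogeneousPart_zero_le C hx)
    (fejerConst_nonneg m k))

theorem jointNumericalRadius_adjoint_sub_le (h : harmonicPoly m A ≤ harmonicPoly m B) {k : ℕ}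
    (hk : 1 ≤ k) (hkm : k ≤ m - 1) :
    jointNumericalRadius (fun α : Words (Fin n) k =>
        ContinuousLinearMap.adjoint (B α) - ContinuousLinearMap.adjoint (A α)) ≤
      ‖(realPart (B 1 - A 1) : H →L[ℂ] H)‖ * fejerConst m k := by
  have difference_nonneg : 0 ≤ harmonicPoly m (B - A) := by
    rwa [harmonicPoly_sub, sub_nonneg]
  simpa only [Pi.sub_apply, map_sub] using
    (jointNumericalRadius_adjoint_le (B - A) (by omega)).trans
      (numericalRadius_homogeneousPart_le difference_nonneg hk hkm)

theorem sum_pow_mul_jointNumericalRadius_adjoint_le (h : harmonicPoly m A ≤ harmonicPoly m B)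
    {t r : ℝ} (ht : IsBohrRadius m t) (hr : 0 ≤ r) (hrt : r ≤ t) :
    ∑ k ∈ Finset.Icc 1 (m - 1), r ^ k *
        jointNumericalRadius (fun α : Words (Fin n) k => ContinuousLinearMap.adjoint (A α)) ≤
      1 / 2 * ‖(realPart (B 1 - A 1) : H →L[ℂ] H)‖ + ∑ k ∈ Finset.Icc 1 (m - 1), r ^ k *
        jointNumericalRadius (fun α : Words (Fin n) k => ContinuousLinearMap.adjoint (B α)) := by
  set D := ‖(realPart (B 1 - A 1) : H →L[ℂ] H)‖
  let w (C : FreeMonoid (Fin n) → H →L[ℂ] H) (k : ℕ) : ℝ :=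
    jointNumericalRadius (fun α : Words (Fin n) k => ContinuousLinearMap.adjoint (C α))
  have radius_le {k : ℕ} (hk : k ∈ Finset.Icc 1 (m - 1)) : w A k ≤ D * fejerConst m k + w B k := by
    obtain ⟨hk1, hkm⟩ := Finset.mem_Icc.1 hk
    have triangle := jointNumericalRadius_sub_le
      (fun α : Words (Fin n) k => ContinuousLinearMap.adjoint (B α))
      (fun α => ContinuousLinearMap.adjoint (B α) - ContinuousLinearMap.adjoint (A α))
    simp only [sub_sub_cancel] at triangle
    linarith [jointNumericalRadius_adjoint_sub_le h hk1 hkm]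
  calc ∑ k ∈ Finset.Icc 1 (m - 1), r ^ k * w A k
      ≤ ∑ k ∈ Finset.Icc 1 (m - 1), (t ^ k * (D * fejerConst m k) + r ^ k * w B k) := by
        refine Finset.sum_le_sum fun k hk => ?_
        have hD : 0 ≤ D * fejerConst m k := mul_nonneg (norm_nonneg _) (fejerConst_nonneg m k)
        calc r ^ k * w A k ≤ r ^ k * (D * fejerConst m k + w B k) := by gcongr; exact radius_le hk
          _ ≤ t ^ k * (D * fejerConst m k) + r ^ k * w B k := by rw [mul_add]; gcongr
    _ = 1 / 2 * D + ∑ k ∈ Finset.Icc 1 (m - 1), r ^ k * w B k := by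
        rw [Finset.sum_add_distrib, ← ht.2, Finset.sum_mul]
        simp only [mul_assoc, mul_comm D]

end HarmonicPoly

end NCHarmonic

end

theorem theorem3p2_general {H : Type*} [NormedAddCommGroup H] [InnerProductSpace ℂ H]
    [CompleteSpace H] (n m : ℕ) (hm : 2 ≤ m) :
    (∃! t : ℝ, NCHarmonic.IsBohrRadius m t) ∧
    ∀ A B : FreeMonoid (Fin n) → H →L[ℂ] H,
      NCHarmonic.harmonicPoly m A ≤ NCHarmonic.harmonicPoly m B →
      (∀ k : ℕ, 1 ≤ k → k ≤ m - 1 →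
        NCHarmonic.jointNumericalRadius
            (fun α : NCHarmonic.Words (Fin n) k =>
              ContinuousLinearMap.adjoint (B α) - ContinuousLinearMap.adjoint (A α))
          ≤ ‖(realPart (B 1 - A 1) : H →L[ℂ] H)‖ * NCHarmonic.fejerConst m k) ∧
      (∀ t : ℝ, NCHarmonic.IsBohrRadius m t → ∀ r : ℝ, 0 ≤ r → r ≤ t →
        ∑ k ∈ Finset.Icc 1 (m - 1), r ^ k *
            NCHarmonic.jointNumericalRadius
              (fun α : NCHarmonic.Words (Fin n) k => ContinuousLinearMap.adjoint (A α))
          ≤ 1 / 2 * ‖(realPart (B 1 - A 1) : H →L[ℂ] H)‖ +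
            ∑ k ∈ Finset.Icc 1 (m - 1), r ^ k *
              NCHarmonic.jointNumericalRadius
                (fun α : NCHarmonic.Words (Fin n) k => ContinuousLinearMap.adjoint (B α))) :=
  ⟨NCHarmonic.existsUnique_isBohrRadius hm, fun _ _ h =>
    ⟨fun _ hk hkm => NCHarmonic.jointNumericalRadius_adjoint_sub_le h hk hkm, fun _ ht _ hr hrt =>
      NCHarmonic.sum_pow_mul_jointNumericalRadius_adjoint_le h ht hr hrt⟩⟩

theorem theorem3p2 {H : Type*} [NormedAddCommGroup H] [InnerProductSpace ℂ H] [CompleteSpace H]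
    (n : ℕ) (hn : 1 ≤ n) (m : ℕ) (hm : 2 ≤ m) :
    (∃! t : ℝ, NCHarmonic.IsBohrRadius m t) ∧
    ∀ A B : FreeMonoid (Fin n) → H →L[ℂ] H,
      IsSelfAdjoint (A 1) → IsSelfAdjoint (B 1) →
      NCHarmonic.harmonicPoly m A ≤ NCHarmonic.harmonicPoly m B →
      (∀ k : ℕ, 1 ≤ k → k ≤ m - 1 →
        NCHarmonic.jointNumericalRadius
            (fun α : NCHarmonic.Words (Fin n) k =>
              ContinuousLinearMap.adjoint (B α) - ContinuousLinearMap.adjoint (A α))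
          ≤ ‖B 1 - A 1‖ * NCHarmonic.fejerConst m k) ∧
      (∀ t : ℝ, NCHarmonic.IsBohrRadius m t → ∀ r : ℝ, 0 ≤ r → r ≤ t →
        ∑ k ∈ Finset.Icc 1 (m - 1), r ^ k *
            NCHarmonic.jointNumericalRadius
              (fun α : NCHarmonic.Words (Fin n) k => ContinuousLinearMap.adjoint (A α))
          ≤ 1 / 2 * ‖B 1 - A 1‖ +
            ∑ k ∈ Finset.Icc 1 (m - 1), r ^ k *
              NCHarmonic.jointNumericalRadius
                (fun α : NCHarmonic.Words (Fin n) k => ContinuousLinearMap.adjoint (B α))) := by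
  refine ⟨(theorem3p2_general (H := H) n m hm).1, fun A B hA hB h => ?_⟩
  simpa only [(hB.sub hA).coe_realPart] using (theorem3p2_general n m hm).2 A B h
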